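/- Let $\mathsf{T}$ be a rigidly-compactly generated tensor triangulated category, that is, a triangulated category with all set-indexed coproducts and a symmetric monoidal structure $(\otimes,\mathbf 1)$ whose tensor product is exact and coproduct preserving in each variable, such that $\mathsf{T}$ is generated by a set of compact objects and the compact objects contain $\mathbf 1$, are closed under $\otimes$ and form a rigid category. Let $\mathrm{Loc}^\otimes(\mathsf{T})$ be the (possibly large) complete lattice of localizing tensor-ideals of $\mathsf{T}$ ordered by inclusion, and for a class of objects $\mathcal M$ let $\mathrm{loc}^\otimes(\mathcal M)$ be the smallest localizing tensor-ideal containing $\mathcal M$. A map of complete lattices is a map preserving arbitrary joins and finite meets (including the empty meet). An idempotent algebra is an object $A$ with a morphism $\eta\colon \mathbf 1\to A$ such that $A\otimes\eta$ is an isomorphism; the corresponding idempotent coalgebra $C$ is defined by a distinguished triangle $C\to\mathbf 1\xrightarrow{\eta}A\to\Sigma C$, and the corresponding smashing ideal is $\{M\in\mathsf{T}\mid A\otimes M\cong 0\}$. Let $\mathrm{Idem}(\mathsf{T})$ be the poset of isomorphism classes of idempotent algebras, where $A_1\le A_2$ if there is a morphism $A_1\to A_2$ compatible with the units. Let $F$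 be a spatial frame whose space of points $\mathrm{pt}(F)$ is $T_D$ (every point is locally closed), and write $U_f=\{p\in \mathrm{pt}(F)\mid p(f)=1\}$ for $f\in F$. Let $\tau\colon F\to\mathrm{Idem}(\mathsf{T})$ be an injective map preserving arbitrary joins and finite meets; write $A_{\tau f}$ and $C_{\tau f}$ for the idempotent algebra and the idempotent coalgebra given by $\tau(f)$, and regard $\tau(f)$ also as the corresponding smashing ideal in $\mathrm{Loc}^\otimes(\mathsf{T})$. For each $p\in\mathrm{pt}(F)$ choose $f,g\in F$ with $\{p\}=U_f\cap(\mathrm{pt}(F)\setminus U_g)$ and put $\Gamma_p=C_{\tau f}\otimes A_{\tau g}$. Define $$\upsilon\colon\mathcal P(\mathrm{pt}(F))\to\mathrm{Loc}^\otimes(\mathsf{T}),\qquad \upsilon(W)=\mathrm{loc}^\otimes(\Gamma_p\mid p\in W).$$ Suppose that $\tau$ satisfies the local-to-global principle, i.e. $\mathsf{T}=\mathrm{loc}^\otimes(\Gamma_p\mid p\in\mathrm{pt}(F))$. Then $\upsilon$ is a discretization of $\tau$: it is an injective map of complete lattices and $\upsilon(U_f)=\tau(f)$ for every $f\in F$.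 Moreover $\upsilon$ preserves arbitrary meets. -/

import Mathlib

open CategoryTheory CategoryTheory.Limits CategoryTheory.Pretriangulated MonoidalCategory ZeroObject

set_option linter.unusedSectionVars false

universe v u w

namespace BigTT

/-! ### Big tensor triangulated categories -/

section Categories

variable (T : Type u) [Category.{v} T] [HasZeroObject T] [HasShift T ℤ] [Preadditive T]
  [∀ n : ℤ, (shiftFunctor T n).Additive] [Pretriangulated T]
  [MonoidalCategory T] [SymmetricCategory T]

/-- The tensor product is an exact and coproduct preserving functor in each variable. Since the
monoidal structure is symmetric, `tensorRight X` is isomorphic to `tensorLeft X`, so that it is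
enough to require this in one of the two variables. -/
class IsTensorTriangulated : Prop where
  exact_tensorLeft : ∀ X : T, ∃ _ : (tensorLeft X).CommShift ℤ, (tensorLeft X).IsTriangulated
  coproducts_tensorLeft : ∀ (X : T) (J : Type v), PreservesColimitsOfShape (Discrete J) (tensorLeft X)

variable {T} in
/-- An object `t` is compact if any morphism from `t` to a set-indexed coproduct factors through
a finite subcoproduct. -/
def IsCompactObj [HasCoproducts.{v} T] (t : T) : Prop :=
  ∀ (J : Type v) (M : J → T) (f : t ⟶ ∐ M),
    ∃ (s : Finset J) (g : t ⟶ ∐ fun j : s => M j),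
      f = g ≫ Sigma.desc fun j : s => Sigma.ι M (j : J)

/-- A rigidly-compactly generated tensor triangulated category: there is a set of compact objects
detecting zero objects, the compact objects are closed under the tensor product and contain the
unit, and every compact object has a dual among the compact objects. -/
class IsBigTTCategory [HasCoproducts.{v} T] : Prop extends IsTensorTriangulated T where
  compactly_generated : ∃ (I : Type v) (G : I → T), (∀ i, IsCompactObj (G i)) ∧
    ∀ M : T, (∀ (i : I) (n : ℤ) (f : G i ⟶ M⟦n⟧), f = 0) → IsZero M
  compact_unit : IsCompactObj (𝟙_ T)
  compact_tensor : ∀ a b : T, IsCompactObj a → IsCompactObj b → IsCompactObj (a ⊗ b)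
  rigid : ∀ a : T, IsCompactObj a → ∃ b : T, IsCompactObj b ∧ Nonempty (ExactPairing a b)

/-! ### Localizing tensor-ideals -/

/-- A localizing tensor-ideal of `T`: a full (replete) triangulated subcategory closed under
set-indexed coproducts and under tensoring with arbitrary objects of `T`. -/
@[ext]
structure LocIdeal where
  mem : ObjectProperty T
  isTriangulated : mem.IsTriangulated
  isClosedUnderIsomorphisms : mem.IsClosedUnderIsomorphisms
  coproducts : ∀ J : Type v, mem.IsClosedUnderColimitsOfShape (Discrete J)
  tensor : ∀ X Y : T, mem Y → mem (X ⊗ Y)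

variable {T}

namespace LocIdeal

/-- Localizing tensor-ideals are ordered by inclusion. -/
instance : PartialOrder (LocIdeal T) :=
  PartialOrder.lift (fun L => L.mem) fun _ _ h => LocIdeal.ext h

/-- The meet of a collection of localizing tensor-ideals is their intersection. -/
instance : InfSet (LocIdeal T) where
  sInf S :=
    { mem := fun X => ∀ L ∈ S, L.mem X
      isTriangulated :=
        { exists_zero := ⟨0, isZero_zero T, fun L _ => by
            have := L.isTriangulated
            have := L.isClosedUnderIsomorphisms
            exact L.mem.prop_zero⟩
          isStableUnderShiftBy := fun n => ⟨fun X hX L hL => by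
            have := L.isTriangulated
            exact L.mem.le_shift n X (hX L hL)⟩
          ext₂' := fun D hD h₁ h₃ => ObjectProperty.le_isoClosure _ _ fun L hL => by
            have := L.isTriangulated
            have := L.isClosedUnderIsomorphisms
            exact L.mem.ext_of_isTriangulatedClosed₂ D hD (h₁ L hL) (h₃ L hL) }
      isClosedUnderIsomorphisms := ⟨fun e hX L hL => by
        have := L.isClosedUnderIsomorphisms
        exact L.mem.prop_of_iso e (hX L hL)⟩
      coproducts := fun J => ⟨fun X ⟨h⟩ L hL => by
        have := L.coproducts J
        exact L.mem.prop_of_isColimit h.isColimit fun j => h.prop_diag_obj j L hL⟩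
      tensor := fun X Y hY L hL => L.tensor X Y (hY L hL) }

/-- The complete lattice of localizing tensor-ideals: meets are intersections, and the join of a
family is the smallest localizing tensor-ideal containing all its members. -/
instance : CompleteLattice (LocIdeal T) :=
  completeLatticeOfInf _ fun _ => ⟨fun L hL _ hX => hX L hL, fun _ hB X hX _ hL => hB hL X hX⟩

/-- The localizing tensor-ideal `loc^⊗(𝓜)` generated by a class of objects `𝓜`. -/
def generate (𝓜 : Set T) : LocIdeal T :=
  sInf {L | ∀ X ∈ 𝓜, L.mem X}

end LocIdeal

/-! ### Idempotent algebras -/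

variable (T) in
/-- An idempotent algebra: an object `A` with a morphism `η : 𝟙 ⟶ A` such that
`A ⊗ η : A ⊗ 𝟙 ⟶ A ⊗ A` is an isomorphism. -/
structure IdemAlg where
  obj : T
  unit : 𝟙_ T ⟶ obj
  isIso : IsIso (obj ◁ unit)

/-- `A₁ ≤ A₂` if there is a morphism `A₁ ⟶ A₂` compatible with the units. -/
instance : Preorder (IdemAlg T) where
  le A₁ A₂ := ∃ φ : A₁.obj ⟶ A₂.obj, A₁.unit ≫ φ = A₂.unit
  le_refl A := ⟨𝟙 _, by simp⟩
  le_trans A₁ A₂ A₃ := fun ⟨φ, hφ⟩ ⟨ψ, hψ⟩ => ⟨φ ≫ ψ, by rw [← Category.assoc, hφ, hψ]⟩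

variable (T) in
/-- The poset of idempotent algebras: isomorphic idempotent algebras are identified. -/
abbrev Idem := Antisymmetrization (IdemAlg T) (· ≤ ·)

/-- `A` is an idempotent algebra in the isomorphism class `x`. -/
def IdemAlg.Represents (A : IdemAlg T) (x : Idem T) : Prop :=
  toAntisymmetrization (· ≤ ·) A = x

/-- `C` is the idempotent coalgebra corresponding to the idempotent algebra `A`, i.e. it sits in a
distinguished triangle `C ⟶ 𝟙 ⟶ A ⟶ ΣC` whose second map is the unit of `A`. -/
def IdemAlg.IsCoalgebra (A : IdemAlg T) (C : T) : Prop :=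
  ∃ (ε : C ⟶ 𝟙_ T) (δ : A.obj ⟶ C⟦(1 : ℤ)⟧), Triangle.mk ε A.unit δ ∈ distTriang T

theorem isZero_tensor {A X : T} [IsTensorTriangulated T] (h : IsZero X) : IsZero (A ⊗ X) := by
  obtain ⟨_, _⟩ := IsTensorTriangulated.exact_tensorLeft A
  exact (tensorLeft A).map_isZero h

/-- The smashing ideal corresponding to an idempotent algebra `A`: the localizing tensor-ideal
`ker(A ⊗ -)` of the objects annihilated by `A`. -/
def IdemAlg.ker [IsTensorTriangulated T] (A : IdemAlg T) : LocIdeal T where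
  mem X := IsZero (A.obj ⊗ X)
  isTriangulated :=
    { exists_zero := ⟨0, isZero_zero T, isZero_tensor (isZero_zero T)⟩
      isStableUnderShiftBy := fun n => ⟨fun X hX => by
        obtain ⟨_, _⟩ := IsTensorTriangulated.exact_tensorLeft A.obj
        exact ((shiftFunctor T n).map_isZero hX).of_iso
          (((tensorLeft A.obj).commShiftIso n).app X)⟩
      ext₂' := fun D hD h₁ h₃ => ObjectProperty.le_isoClosure _ _ <| by
        obtain ⟨_, _⟩ := IsTensorTriangulated.exact_tensorLeft A.obj
        exact Triangle.isZero₂_of_isZero₁₃ _ ((tensorLeft A.obj).map_distinguished D hD) h₁ h₃ }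
  isClosedUnderIsomorphisms := ⟨fun e hX => hX.of_iso ((tensorLeft A.obj).mapIso e.symm)⟩
  coproducts J := ⟨fun X ⟨h⟩ => by
    have := IsTensorTriangulated.coproducts_tensorLeft A.obj J
    have hc := isColimitOfPreserves (tensorLeft A.obj) h.isColimit
    rw [IsZero.iff_id_eq_zero]
    exact hc.hom_ext fun j => (h.prop_diag_obj j).eq_of_src _ _⟩
  tensor X Y hY := by
    have e : A.obj ⊗ (X ⊗ Y) ≅ X ⊗ (A.obj ⊗ Y) :=
      (α_ _ _ _).symm ≪≫ whiskerRightIso (β_ _ _) Y ≪≫ α_ _ _ _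
    exact (isZero_tensor hY).of_iso e

theorem IdemAlg.ker_mono [IsTensorTriangulated T] {A₁ A₂ : IdemAlg T} (h : A₁ ≤ A₂) :
    A₁.ker ≤ A₂.ker := by
  obtain ⟨φ, hφ⟩ := h
  intro X (hX : IsZero (A₁.obj ⊗ X))
  change IsZero (A₂.obj ⊗ X)
  have := A₂.isIso
  have h0 : IsZero ((A₂.obj ⊗ A₁.obj) ⊗ X) :=
    (isZero_tensor hX).of_iso (α_ A₂.obj A₁.obj X)
  have h1 : A₂.obj ◁ A₁.unit ≫ A₂.obj ◁ φ ≫ inv (A₂.obj ◁ A₂.unit) = 𝟙 _ := by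
    rw [← Category.assoc, ← MonoidalCategory.whiskerLeft_comp, hφ, IsIso.hom_inv_id]
  have h2 : IsZero ((A₂.obj ⊗ 𝟙_ T) ⊗ X) := by
    rw [IsZero.iff_id_eq_zero, ← MonoidalCategory.id_whiskerRight, ← h1,
      MonoidalCategory.comp_whiskerRight]
    rw [h0.eq_of_tgt ((A₂.obj ◁ A₁.unit) ▷ X) 0, zero_comp]
  exact h2.of_iso (whiskerRightIso (ρ_ A₂.obj).symm X)

/-- The smashing ideal corresponding to an isomorphism class of idempotent algebras. -/
def Idem.toLocIdeal [IsTensorTriangulated T] (x : Idem T) : LocIdeal T :=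
  Quotient.lift (s := AntisymmRel.setoid (IdemAlg T) (· ≤ ·)) (fun A : IdemAlg T => A.ker)
    (fun A B (h : AntisymmRel (· ≤ ·) A B) =>
      le_antisymm (IdemAlg.ker_mono h.1) (IdemAlg.ker_mono h.2)) x

end Categories

/-! ### Frames and their points -/

/-- A frame is spatial if it is isomorphic to the frame of open sets of a topological space. -/
def IsSpatial (F : Type w) [Order.Frame F] : Prop :=
  ∃ (X : Type w) (_ : TopologicalSpace X), Nonempty (F ≃o TopologicalSpace.Opens X)

/-- A frame is `T_D` if every point of its space of points is locally closed. -/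
def IsTD (F : Type w) [Order.Frame F] : Prop :=
  ∀ p : Locale.PT F, IsLocallyClosed ({p} : Set (Locale.PT F))

/-- The open subset `U_f = {p | p(f) = 1}` of the space of points of `F`. -/
def openSet {F : Type w} [Order.Frame F] (f : F) : Set (Locale.PT F) := {p | p f}

/-- A map of posets `τ : F → P` out of a complete lattice preserves arbitrary joins and finite
meets (which in particular exist in `P` for elements in the image). -/
structure IsFrameMap {F : Type*} {P : Type*} [CompleteLattice F] [PartialOrder P]
    (τ : F → P) : Prop where
  isLUB : ∀ S : Set F, IsLUB (τ '' S) (τ (sSup S))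
  isGLB : ∀ f g : F, IsGLB {τ f, τ g} (τ (f ⊓ g))
  isTop : IsTop (τ ⊤)

/-! ### Discretizations and the local-to-global principle -/

section Discretization

variable {T : Type u} [Category.{v} T] [HasZeroObject T] [HasShift T ℤ] [Preadditive T]
  [∀ n : ℤ, (shiftFunctor T n).Additive] [Pretriangulated T]
  [MonoidalCategory T] [SymmetricCategory T] {F : Type w} [Order.Frame F]

/-- `X` is the idempotent `Γ_p` at the point `p`: `X ≅ C_{τ f} ⊗ A_{τ g}` for some `f, g` in `F`
with `{p} = U_f ∩ V_g`, where `V_g` is the complement of `U_g`. -/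
def IsPointIdempotent (τ : F → Idem T) (p : Locale.PT F) (X : T) : Prop :=
  ∃ (f g : F) (A B : IdemAlg T) (C : T), {p} = openSet f ∩ (openSet g)ᶜ ∧
    A.Represents (τ f) ∧ A.IsCoalgebra C ∧ B.Represents (τ g) ∧ Nonempty (X ≅ C ⊗ B.obj)

/-- If `F` is `T_D`, then the idempotents `Γ_p` exist. -/
theorem exists_isPointIdempotent (hTD : IsTD F) (τ : F → Idem T) :
    ∃ Γ : Locale.PT F → T, ∀ p, IsPointIdempotent τ p (Γ p) := by
  refine Classical.skolem.mp fun p => ?_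
  obtain ⟨U, Z, ⟨f, hf⟩, hZ, hp⟩ := hTD p
  obtain ⟨g, hg⟩ := hZ.isOpen_compl
  obtain ⟨A, hA⟩ := Quotient.exists_rep (τ f)
  obtain ⟨B, hB⟩ := Quotient.exists_rep (τ g)
  obtain ⟨C, ε, δ, hC⟩ := distinguished_cocone_triangle₁ A.unit
  refine ⟨C ⊗ B.obj, f, g, A, B, C, ?_, hA, ⟨ε, δ, hC⟩, hB, ⟨Iso.refl _⟩⟩
  rw [hp, openSet, openSet, hf, hg, compl_compl]

/-- The map `υ(W) = loc^⊗(Γ_p | p ∈ W)`. -/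
def refinement (Γ : Locale.PT F → T) (W : Set (Locale.PT F)) : LocIdeal T :=
  LocIdeal.generate (Γ '' W)

/-- The local-to-global principle: `T = loc^⊗(Γ_p | p ∈ pt F)`. -/
def LocalToGlobal (Γ : Locale.PT F → T) : Prop :=
  refinement Γ Set.univ = ⊤

/-- A discretization of `τ`: an injective map of complete lattices `υ` (it preserves arbitrary
joins and finite meets) from the power set of `pt F` to the localizing tensor-ideals such that
`υ(U_f)` is the smashing ideal given by `τ f`. -/
structure IsDiscretization [IsTensorTriangulated T] (τ : F → Idem T)
    (υ : FrameHom (Set (Locale.PT F)) (LocIdeal T)) : Prop where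
  injective : Function.Injective υ
  comm : ∀ f : F, υ (openSet f) = (τ f).toLocIdeal

end Discretization

end BigTT

/-! The ideal `υ(W)` consists of the objects supported on `W`: those `X` with `Γ_p ⊗ X ≅ 0` for all
`p ∉ W` (`refinement_mem_iff`). This rests on two facts. The `Γ_p` are pairwise orthogonal
(`IsPointIdempotent.isZero_tensor`). By local-to-global, `X` lies in an ideal as soon as every `Γ_p
⊗ X` does, because `𝟙` is built from the `Γ_p`. Meets are then compared by support, while joins are
formal. Injectivity needs also `Γ_p ≇ 0`, which comes from injectivity of `τ`. The equality `υ(U_f)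
= τ(f)` holds because `A_{τ f}` kills `Γ_p` for `p ∈ U_f`, while `C_{τ f}` is killed by `Γ_p` for `p
∉ U_f`. All the vanishing comes from inequalities in `F`, which spatiality reads off from inclusions
of sets of points. -/

namespace BigTT

section TensorTriangulated

variable {T : Type u} [Category.{v} T] [HasZeroObject T] [HasShift T ℤ] [Preadditive T]
  [∀ n : ℤ, (shiftFunctor T n).Additive] [Pretriangulated T]
  [MonoidalCategory T] [SymmetricCategory T]

/-! ### Tensoring with a fixed object -/

theorem isZero_tensor_comm {X Y : T} (h : IsZero (X ⊗ Y)) : IsZero (Y ⊗ X) :=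
  h.of_iso (β_ Y X)

theorem isZero_tensor_assoc {X Y Z : T} (h : IsZero (X ⊗ Y ⊗ Z)) : IsZero ((X ⊗ Y) ⊗ Z) :=
  h.of_iso (α_ X Y Z)

theorem isZero_tensor_assoc' {X Y Z : T} (h : IsZero ((X ⊗ Y) ⊗ Z)) : IsZero (X ⊗ Y ⊗ Z) :=
  h.of_iso (α_ X Y Z).symm

theorem isZero_tensor_left_comm {X Y Z : T} (h : IsZero (X ⊗ Y ⊗ Z)) : IsZero (Y ⊗ X ⊗ Z) :=
  h.of_iso ((α_ _ _ _).symm ≪≫ whiskerRightIso (β_ _ _) Z ≪≫ α_ _ _ _)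

variable [IsTensorTriangulated T]

theorem isIso_whiskerLeft_mor₁_iff (X : T) {D : Triangle T} (hD : D ∈ distTriang T) :
    IsIso (X ◁ D.mor₁) ↔ IsZero (X ⊗ D.obj₃) := by
  obtain ⟨_, _⟩ := IsTensorTriangulated.exact_tensorLeft X
  exact (Triangle.isZero₃_iff_isIso₁ _ ((tensorLeft X).map_distinguished D hD)).symm

theorem isIso_whiskerLeft_mor₂_iff (X : T) {D : Triangle T} (hD : D ∈ distTriang T) :
    IsIso (X ◁ D.mor₂) ↔ IsZero (X ⊗ D.obj₁) := by
  obtain ⟨_, _⟩ := IsTensorTriangulated.exact_tensorLeft X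
  exact (Triangle.isZero₁_iff_isIso₂ _ ((tensorLeft X).map_distinguished D hD)).symm

theorem isIso_whiskerLeft_whiskerLeft (X Y : T) {Z W : T} (f : Z ⟶ W) [IsIso ((X ⊗ Y) ◁ f)] :
    IsIso (X ◁ Y ◁ f) := by
  rw [tensor_whiskerLeft_symm]
  infer_instance

/-- The localizing tensor-ideal of the objects `Y` with `X ⊗ Y` in `L`. -/
def LocIdeal.comapTensor (X : T) (L : LocIdeal T) : LocIdeal T where
  mem Y := L.mem (X ⊗ Y)
  isTriangulated :=
    have := L.isTriangulated
    have := L.isClosedUnderIsomorphisms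
    { exists_zero := ⟨0, isZero_zero T, L.mem.prop_of_isZero (isZero_tensor (isZero_zero T))⟩
      isStableUnderShiftBy := fun n => ⟨fun Y hY => by
        obtain ⟨_, _⟩ := IsTensorTriangulated.exact_tensorLeft X
        exact L.mem.prop_of_iso (((tensorLeft X).commShiftIso n).app Y).symm
          (L.mem.le_shift n _ hY)⟩
      ext₂' := fun D hD h₁ h₃ => ObjectProperty.le_isoClosure _ _ <| by
        obtain ⟨_, _⟩ := IsTensorTriangulated.exact_tensorLeft X
        exact L.mem.ext_of_isTriangulatedClosed₂ _ ((tensorLeft X).map_distinguished D hD) h₁ h₃ }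
  isClosedUnderIsomorphisms := ⟨fun e hY => by
    have := L.isClosedUnderIsomorphisms
    exact L.mem.prop_of_iso (whiskerLeftIso X e) hY⟩
  coproducts J := ⟨fun Y ⟨h⟩ => by
    have := IsTensorTriangulated.coproducts_tensorLeft X J
    have := L.coproducts J
    exact L.mem.prop_of_isColimit (isColimitOfPreserves (tensorLeft X) h.isColimit)
      h.prop_diag_obj⟩
  tensor Y Z hZ := by
    have := L.isClosedUnderIsomorphisms
    exact L.mem.prop_of_iso
      ((α_ _ _ _).symm ≪≫ whiskerRightIso (β_ _ _) Z ≪≫ α_ _ _ _) (L.tensor Y (X ⊗ Z) hZ)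

/-- The trivial idempotent algebra `𝟙`. -/
def IdemAlg.one : IdemAlg T := ⟨𝟙_ T, 𝟙 _, inferInstance⟩

/-- The annihilator of `X`: the localizing tensor-ideal of the objects `Y` with `X ⊗ Y ≅ 0`. -/
def annihilator (X : T) : LocIdeal T := IdemAlg.one.ker.comapTensor X

theorem mem_annihilator {X Y : T} : (annihilator X).mem Y ↔ IsZero (X ⊗ Y) :=
  (λ_ (X ⊗ Y)).isZero_iff

namespace LocIdeal

theorem mem_generate {𝓜 : Set T} {X : T} (hX : X ∈ 𝓜) : (generate 𝓜).mem X :=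
  fun _ hL => hL X hX

theorem generate_le {𝓜 : Set T} {L : LocIdeal T} (h : ∀ X ∈ 𝓜, L.mem X) : generate 𝓜 ≤ L :=
  sInf_le h

theorem mem_top (X : T) : (⊤ : LocIdeal T).mem X := by
  rw [← sInf_empty]
  exact fun L hL => hL.elim

/-- If a class of objects generates everything, then membership in a localizing tensor-ideal can be
tested after tensoring with the objects of this class. -/
theorem mem_of_generate_eq_top {𝓜 : Set T} (h𝓜 : generate 𝓜 = ⊤) {L : LocIdeal T} {X : T}
    (h : ∀ Y ∈ 𝓜, L.mem (Y ⊗ X)) : L.mem X := by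
  have := L.isClosedUnderIsomorphisms
  have hle : generate 𝓜 ≤ L.comapTensor X :=
    generate_le fun Y hY => L.mem.prop_of_iso (β_ Y X) (h Y hY)
  -- The ideal of all `Y` with `X ⊗ Y` in `L` now contains `𝟙`.
  rw [h𝓜] at hle
  exact L.mem.prop_of_iso (ρ_ X) (hle _ (mem_top (𝟙_ T)))

end LocIdeal

/-! ### Idempotent algebras and coalgebras -/

namespace IdemAlg

variable {A B : IdemAlg T} {C D : T}

theorem exists_isCoalgebra (A : IdemAlg T) : ∃ C : T, A.IsCoalgebra C := by
  obtain ⟨C, ε, δ, h⟩ := distinguished_cocone_triangle₁ A.unit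
  exact ⟨C, ε, δ, h⟩

theorem IsCoalgebra.isZero_tensor (h : A.IsCoalgebra C) : IsZero (A.obj ⊗ C) := by
  obtain ⟨ε, δ, h⟩ := h
  exact (isIso_whiskerLeft_mor₂_iff A.obj h).1 A.isIso

/-- If `B` annihilates the coalgebra of `A`, then `A ≤ B`. -/
theorem IsCoalgebra.le (h : A.IsCoalgebra C) (hB : IsZero (B.obj ⊗ C)) : A ≤ B := by
  obtain ⟨ε, δ, h⟩ := h
  -- The composite `C ⟶ 𝟙 ⟶ B` factors through `C ⊗ B ≅ 0`, so the unit of `B` extends along that of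
  -- `A`.
  have hε : ε ≫ B.unit = 0 := by
    have hz := isZero_tensor_comm hB
    have : (ρ_ C).inv ≫ C ◁ B.unit ≫ ε ▷ B.obj ≫ (λ_ B.obj).hom = ε ≫ B.unit := by
      rw [whisker_exchange_assoc]
      simp [← unitors_inv_equal]
    rw [← this, hz.eq_of_tgt (C ◁ B.unit) 0]
    simp
  obtain ⟨φ, hφ⟩ := Triangle.yoneda_exact₂ _ h B.unit hε
  exact ⟨φ, hφ.symm⟩

/-- The tensor product of two idempotent algebras. -/
def tensor (A B : IdemAlg T) : IdemAlg T where
  obj := A.obj ⊗ B.obj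
  unit := A.unit ≫ (ρ_ A.obj).inv ≫ A.obj ◁ B.unit
  isIso := by
    -- The unit is built from those of `A` and `B`; each becomes invertible because `A ⊗ B` kills
    -- its fibre.
    have h₁ : IsIso ((A.obj ⊗ B.obj) ◁ A.unit) := by
      obtain ⟨C, hC⟩ := A.exists_isCoalgebra
      obtain ⟨ε, δ, h⟩ := id hC
      exact (isIso_whiskerLeft_mor₂_iff _ h).2 (isZero_tensor_assoc
        (isZero_tensor_left_comm (BigTT.isZero_tensor hC.isZero_tensor)))
    have h₂ : IsIso ((A.obj ⊗ B.obj) ◁ A.obj ◁ B.unit) := by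
      obtain ⟨C, hC⟩ := B.exists_isCoalgebra
      obtain ⟨ε, δ, h⟩ := id hC
      have : IsIso (((A.obj ⊗ B.obj) ⊗ A.obj) ◁ B.unit) :=
        (isIso_whiskerLeft_mor₂_iff _ h).2 (isZero_tensor_assoc <| isZero_tensor_assoc <|
          BigTT.isZero_tensor <| isZero_tensor_left_comm <| BigTT.isZero_tensor hC.isZero_tensor)
      exact isIso_whiskerLeft_whiskerLeft _ _ _
    rw [MonoidalCategory.whiskerLeft_comp, MonoidalCategory.whiskerLeft_comp]
    infer_instance

theorem le_tensor_left (A B : IdemAlg T) : A ≤ A.tensor B :=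
  ⟨(ρ_ A.obj).inv ≫ A.obj ◁ B.unit, rfl⟩

theorem le_tensor_right (A B : IdemAlg T) : B ≤ A.tensor B := by
  refine ⟨(λ_ B.obj).inv ≫ A.unit ▷ B.obj, ?_⟩
  change B.unit ≫ (λ_ B.obj).inv ≫ A.unit ▷ B.obj = A.unit ≫ (ρ_ A.obj).inv ≫ A.obj ◁ B.unit
  rw [leftUnitor_inv_naturality_assoc, whisker_exchange, unitors_inv_equal,
    rightUnitor_inv_naturality_assoc]

/-- The tensor product of two idempotent coalgebras is an idempotent coalgebra. -/
theorem exists_isCoalgebra_tensor (hC : A.IsCoalgebra C) (hD : B.IsCoalgebra D) :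
    ∃ E : IdemAlg T, E.IsCoalgebra (C ⊗ D) := by
  obtain ⟨ε, δ, h⟩ := id hC
  obtain ⟨ε', δ', h'⟩ := id hD
  have hCA := hC.isZero_tensor
  have hDB := hD.isZero_tensor
  have h₁ : IsIso ((C ⊗ D) ◁ C ◁ ε') := by
    have : IsIso (((C ⊗ D) ⊗ C) ◁ ε') :=
      (isIso_whiskerLeft_mor₁_iff _ h').2 (isZero_tensor_assoc <| isZero_tensor_assoc <|
        BigTT.isZero_tensor <| isZero_tensor_left_comm <| BigTT.isZero_tensor <|
        isZero_tensor_comm hDB)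
    exact isIso_whiskerLeft_whiskerLeft _ _ _
  have h₂ : IsIso ((C ⊗ D) ◁ ε) :=
    (isIso_whiskerLeft_mor₁_iff _ h).2 (isZero_tensor_assoc <| isZero_tensor_left_comm <|
      BigTT.isZero_tensor <| isZero_tensor_comm hCA)
  have h₃ : IsIso ((C ⊗ D) ◁ (C ◁ ε' ≫ (ρ_ C).hom ≫ ε)) := by
    rw [MonoidalCategory.whiskerLeft_comp, MonoidalCategory.whiskerLeft_comp]
    infer_instance
  obtain ⟨E, η, δ'', hE⟩ := distinguished_cocone_triangle (C ◁ ε' ≫ (ρ_ C).hom ≫ ε)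
  -- The cone `E` of `C ⊗ D ⟶ 𝟙` is orthogonal to `C ⊗ D`, which is exactly what makes `E`
  -- idempotent.
  have hz := (isIso_whiskerLeft_mor₁_iff _ hE).1 h₃
  exact ⟨⟨E, η, (isIso_whiskerLeft_mor₂_iff E hE).2 (isZero_tensor_comm hz)⟩, _, _, hE⟩

end IdemAlg

/-! ### Idempotents in the image of a frame map -/

section FrameMap

variable {F : Type w} [Order.Frame F] {τ : F → Idem T}

theorem IdemAlg.le_iff_of_represents {A B : IdemAlg T} {x y : Idem T} (hA : A.Represents x)
    (hB : B.Represents y) : A ≤ B ↔ x ≤ y := by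
  rw [← hA, ← hB, toAntisymmetrization_le_toAntisymmetrization_iff]

theorem Idem.exists_represents (x : Idem T) : ∃ A : IdemAlg T, A.Represents x :=
  Quotient.exists_rep x

theorem IsFrameMap.monotone (hτ : IsFrameMap τ) : Monotone τ := fun f g h => by
  have := (hτ.isGLB f g).1 (Set.mem_insert_of_mem _ rfl)
  rwa [inf_eq_left.2 h] at this

theorem IsFrameMap.le_iff (hτ : IsFrameMap τ) (hinj : Function.Injective τ) {f g : F} :
    τ f ≤ τ g ↔ f ≤ g := by
  refine ⟨fun h => ?_, fun h => hτ.monotone h⟩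
  rw [← inf_eq_left]
  refine hinj ((hτ.isGLB f g).unique ⟨?_, fun x hx => hx (Set.mem_insert _ _)⟩)
  rintro x (rfl | rfl)
  exacts [le_rfl, h]

variable {f f' g g' : F} {A A' B B' : IdemAlg T} {C C' : T}

/-- It suffices that the tensor product is an upper bound; that it is the join is not needed. -/
theorem IsFrameMap.sup_le_tensor (hτ : IsFrameMap τ) (hB : B.Represents (τ g))
    (hB' : B'.Represents (τ g')) :
    τ (g ⊔ g') ≤ toAntisymmetrization (· ≤ ·) (B.tensor B') := by
  rw [← sSup_pair]
  refine (hτ.isLUB {g, g'}).2 ?_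
  rintro _ ⟨x, rfl | rfl, rfl⟩
  · exact (IdemAlg.le_iff_of_represents hB rfl).1 (B.le_tensor_left B')
  · exact (IdemAlg.le_iff_of_represents hB' rfl).1 (B.le_tensor_right B')

theorem IsFrameMap.isZero_of_le_sup (hτ : IsFrameMap τ) (hA : A.Represents (τ f))
    (hC : A.IsCoalgebra C) (hB : B.Represents (τ g)) (hB' : B'.Represents (τ g'))
    (h : f ≤ g ⊔ g') : IsZero ((B.obj ⊗ B'.obj) ⊗ C) :=
  IdemAlg.ker_mono ((IdemAlg.le_iff_of_represents hA rfl).2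
    ((hτ.monotone h).trans (hτ.sup_le_tensor hB hB'))) C hC.isZero_tensor

/-- The algebra `E` with coalgebra `C ⊗ C'` lies below `A` and `A'`, since both kill `C ⊗ C'`. Hence
it lies below `B`, and kernels grow with the algebra. -/
theorem IsFrameMap.isZero_of_inf_le (hτ : IsFrameMap τ) (hA : A.Represents (τ f))
    (hC : A.IsCoalgebra C) (hA' : A'.Represents (τ f')) (hC' : A'.IsCoalgebra C')
    (hB : B.Represents (τ g)) (h : f ⊓ f' ≤ g) : IsZero (B.obj ⊗ (C ⊗ C')) := by
  obtain ⟨E, hE⟩ := IdemAlg.exists_isCoalgebra_tensor hC hC'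
  have hle : toAntisymmetrization (· ≤ ·) E ≤ τ (f ⊓ f') := by
    refine (hτ.isGLB f f').2 ?_
    rintro _ (rfl | rfl)
    · exact (IdemAlg.le_iff_of_represents rfl hA).1
        (hE.le (isZero_tensor_assoc' (isZero_tensor_comm (isZero_tensor hC.isZero_tensor))))
    · exact (IdemAlg.le_iff_of_represents rfl hA').1
        (hE.le (isZero_tensor_left_comm (isZero_tensor hC'.isZero_tensor)))
  exact IdemAlg.ker_mono ((IdemAlg.le_iff_of_represents rfl hB).2 (hle.trans (hτ.monotone h))) _
    hE.isZero_tensor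

end FrameMap

/-! ### The idempotents at points -/

section Points

variable {F : Type w} [Order.Frame F]

theorem openSet_mono {f g : F} (h : f ≤ g) : openSet f ⊆ openSet g :=
  fun p hp => OrderHomClass.mono p h hp

theorem openSet_inf (f g : F) : openSet (f ⊓ g) = openSet f ∩ openSet g := by
  ext p
  exact iff_of_eq (map_inf p f g)

theorem openSet_sup (f g : F) : openSet (f ⊔ g) = openSet f ∪ openSet g := by
  ext p
  exact iff_of_eq (map_sup p f g)

/-- Each point of the underlying space yields a point of the frame, so points detect the order. -/
theorem IsSpatial.le_of_openSet_subset (hF : IsSpatial F) {f g : F}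
    (h : openSet f ⊆ openSet g) : f ≤ g := by
  obtain ⟨X, _, ⟨e⟩⟩ := hF
  rw [← e.le_iff_le]
  intro x hx
  let q : Locale.PT F := (Locale.localePointOfSpacePoint X x).comp (e : FrameHom F _)
  exact h (a := q) hx

variable {τ : F → Idem T} {X Y : T} {p q : Locale.PT F}

/-- If `C ⊗ B` vanished, then `A ≤ B`, hence `f ≤ g` by injectivity of `τ`, and `U_f \ U_g` would be
empty. -/
theorem IsPointIdempotent.not_isZero (hτ : IsFrameMap τ) (hinj : Function.Injective τ)
    (hX : IsPointIdempotent τ p X) : ¬ IsZero X := fun h0 => by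
  obtain ⟨f, g, A, B, C, hp, hA, hC, hB, ⟨e⟩⟩ := hX
  have hle : f ≤ g := (hτ.le_iff hinj).1 ((IdemAlg.le_iff_of_represents hA hB).1
    (hC.le (isZero_tensor_comm (h0.of_iso e.symm))))
  have hmem : p ∈ openSet f ∩ (openSet g)ᶜ := hp ▸ rfl
  exact hmem.2 (openSet_mono hle hmem.1)

theorem IsPointIdempotent.isZero_tensor_of_notMem (hF : IsSpatial F) (hτ : IsFrameMap τ)
    (hX : IsPointIdempotent τ p X) {f : F} {A : IdemAlg T} {C : T} (hA : A.Represents (τ f))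
    (hC : A.IsCoalgebra C) (hp : p ∉ openSet f) : IsZero (X ⊗ C) := by
  obtain ⟨a, b, A', B, C', hab, hA', hC', hB, ⟨e⟩⟩ := hX
  -- The only point of `U_a` outside `U_b` is `p`, which is not in `U_f`.
  have hle : a ⊓ f ≤ b := hF.le_of_openSet_subset <| by
    rw [openSet_inf]
    rintro q ⟨hqa, hqf⟩
    by_contra hqb
    have hq : q ∈ ({p} : Set _) := hab ▸ ⟨hqa, hqb⟩
    exact hp (hq ▸ hqf)
  exact (isZero_tensor_assoc (isZero_tensor_left_comm
    (hτ.isZero_of_inf_le hA' hC' hA hC hB hle))).of_iso (whiskerRightIso e C)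

theorem IsPointIdempotent.isZero_tensor_of_mem (hF : IsSpatial F) (hτ : IsFrameMap τ)
    (hX : IsPointIdempotent τ p X) {f : F} {A : IdemAlg T} (hA : A.Represents (τ f))
    (hp : p ∈ openSet f) : IsZero (A.obj ⊗ X) := by
  obtain ⟨a, b, A', B, C', hab, hA', hC', hB, ⟨e⟩⟩ := hX
  have hle : a ≤ f ⊔ b := hF.le_of_openSet_subset <| by
    rw [openSet_sup]
    intro q hqa
    by_cases hqb : q ∈ openSet b
    · exact Or.inr hqb
    · have hq : q ∈ ({p} : Set _) := hab ▸ ⟨hqa, hqb⟩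
      exact Or.inl (hq ▸ hp)
  have hz := isZero_tensor_assoc' (hτ.isZero_of_le_sup hA' hC' hA hB hle)
  exact (hz.of_iso (whiskerLeftIso A.obj (β_ C' B.obj))).of_iso (whiskerLeftIso A.obj e)

/-- As `p ∉ U_a \ U_b = {q}`, either `p ∈ U_b` and the factor `B` of `Y` kills `X`, or `p ∉ U_a` and
the factor `C` does. -/
theorem IsPointIdempotent.isZero_tensor (hF : IsSpatial F) (hτ : IsFrameMap τ)
    (hX : IsPointIdempotent τ p X) (hY : IsPointIdempotent τ q Y) (hpq : p ≠ q) :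
    IsZero (X ⊗ Y) := by
  obtain ⟨a, b, A, B, C, hab, hA, hC, hB, ⟨e⟩⟩ := id hY
  by_cases hpa : p ∈ openSet a
  · have hpb : p ∈ openSet b := by
      by_contra hpb
      have hp : p ∈ ({q} : Set _) := hab ▸ ⟨hpa, hpb⟩
      exact hpq hp
    have hz := hX.isZero_tensor_of_mem hF hτ hB hpb
    exact (isZero_tensor_left_comm (BigTT.isZero_tensor (isZero_tensor_comm hz))).of_iso
      (whiskerLeftIso X e)
  · have hz := hX.isZero_tensor_of_notMem hF hτ hA hC hpa
    exact (isZero_tensor_assoc' (isZero_tensor_comm (BigTT.isZero_tensor hz))).of_iso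
      (whiskerLeftIso X e)

/-! ### The map `υ` -/

variable {Γ : Locale.PT F → T} {W : Set (Locale.PT F)}

theorem refinement_mem (hp : p ∈ W) : (refinement Γ W).mem (Γ p) :=
  LocIdeal.mem_generate ⟨p, hp, rfl⟩

theorem refinement_le {L : LocIdeal T} (h : ∀ p ∈ W, L.mem (Γ p)) : refinement Γ W ≤ L :=
  LocIdeal.generate_le (by rintro _ ⟨p, hp, rfl⟩; exact h p hp)

theorem refinement_mono {W W' : Set (Locale.PT F)} (h : W ⊆ W') :
    refinement Γ W ≤ refinement Γ W' :=
  refinement_le fun _ hp => refinement_mem (h hp)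

theorem LocalToGlobal.mem_of_forall (hLTG : LocalToGlobal Γ) {L : LocIdeal T}
    (h : ∀ p, L.mem (Γ p ⊗ X)) : L.mem X :=
  LocIdeal.mem_of_generate_eq_top hLTG (by rintro _ ⟨p, -, rfl⟩; exact h p)

theorem LocalToGlobal.isZero_of_forall (hLTG : LocalToGlobal Γ) (h : ∀ p, IsZero (Γ p ⊗ X)) :
    IsZero X :=
  (λ_ X).isZero_iff.1 (hLTG.mem_of_forall (L := IdemAlg.one.ker) fun p => isZero_tensor (h p))

theorem LocIdeal.mem_of_isZero (L : LocIdeal T) (hX : IsZero X) : L.mem X := by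
  have := L.isTriangulated
  have := L.isClosedUnderIsomorphisms
  exact L.mem.prop_of_isZero hX

/-- The localizing tensor-ideal `υ(W)` consists of the objects supported on `W`. -/
theorem refinement_mem_iff (hF : IsSpatial F) (hτ : IsFrameMap τ)
    (hΓ : ∀ p, IsPointIdempotent τ p (Γ p)) (hLTG : LocalToGlobal Γ) :
    (refinement Γ W).mem X ↔ ∀ p ∉ W, IsZero (Γ p ⊗ X) := by
  refine ⟨fun hX p hp => ?_, fun h => hLTG.mem_of_forall fun p => ?_⟩
  -- By orthogonality the annihilator of `Γ p` contains all generators of `υ(W)`.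
  · refine mem_annihilator.1 (refinement_le (L := annihilator (Γ p)) (fun q hq => ?_) X hX)
    refine mem_annihilator.2 ((hΓ p).isZero_tensor hF hτ (hΓ q) ?_)
    rintro rfl
    exact hp hq
  · by_cases hp : p ∈ W
    · have := (refinement Γ W).isClosedUnderIsomorphisms
      exact (refinement Γ W).mem.prop_of_iso (β_ X (Γ p))
        ((refinement Γ W).tensor X _ (refinement_mem hp))
    · exact LocIdeal.mem_of_isZero _ (h p hp)

/-- A point outside the intersection is outside some member, whose vanishing condition then applies.
-/
theorem refinement_sInf (hF : IsSpatial F) (hτ : IsFrameMap τ)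
    (hΓ : ∀ p, IsPointIdempotent τ p (Γ p)) (hLTG : LocalToGlobal Γ)
    (𝒲 : Set (Set (Locale.PT F))) :
    refinement Γ (sInf 𝒲) = sInf (refinement Γ '' 𝒲) := by
  refine le_antisymm (le_sInf ?_) fun X hX => ?_
  · rintro _ ⟨W, hW, rfl⟩
    exact refinement_mono (sInf_le hW)
  · refine (refinement_mem_iff hF hτ hΓ hLTG).2 fun p hp => ?_
    obtain ⟨W, hW, hpW⟩ : ∃ W ∈ 𝒲, p ∉ W := by simpa using hp
    exact (refinement_mem_iff hF hτ hΓ hLTG).1 (hX _ ⟨W, hW, rfl⟩) p hpW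

theorem refinement_sSup (𝒲 : Set (Set (Locale.PT F))) :
    refinement Γ (sSup 𝒲) = sSup (refinement Γ '' 𝒲) := by
  refine le_antisymm (refinement_le ?_) (sSup_le ?_)
  · rintro p ⟨W, hW, hp⟩
    have hle : refinement Γ W ≤ sSup (refinement Γ '' 𝒲) := le_sSup ⟨W, hW, rfl⟩
    exact hle _ (refinement_mem hp)
  · rintro _ ⟨W, hW, rfl⟩
    exact refinement_mono (le_sSup hW)

/-- The map `υ` as a map of complete lattices. -/
def refinementHom (hF : IsSpatial F) (hτ : IsFrameMap τ)
    (hΓ : ∀ p, IsPointIdempotent τ p (Γ p)) (hLTG : LocalToGlobal Γ) :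
    FrameHom (Set (Locale.PT F)) (LocIdeal T) where
  toFun := refinement Γ
  map_inf' W W' := by
    rw [← sInf_pair, refinement_sInf hF hτ hΓ hLTG, Set.image_pair, sInf_pair]
  map_top' := hLTG
  map_sSup' := refinement_sSup

/-- If `p ∉ W`, then `Γ p` is killed by itself, by the support criterion, and by every other `Γ q`,
by orthogonality. Local-to-global would make it zero. -/
theorem mem_of_refinement_mem (hF : IsSpatial F) (hτ : IsFrameMap τ)
    (hinj : Function.Injective τ) (hΓ : ∀ p, IsPointIdempotent τ p (Γ p))
    (hLTG : LocalToGlobal Γ) (h : (refinement Γ W).mem (Γ p)) : p ∈ W := by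
  by_contra hp
  refine (hΓ p).not_isZero hτ hinj (hLTG.isZero_of_forall fun q => ?_)
  by_cases hqp : q = p
  · exact hqp ▸ (refinement_mem_iff hF hτ hΓ hLTG).1 h p hp
  · exact (hΓ q).isZero_tensor hF hτ (hΓ p) hqp

theorem refinement_injective (hF : IsSpatial F) (hτ : IsFrameMap τ)
    (hinj : Function.Injective τ) (hΓ : ∀ p, IsPointIdempotent τ p (Γ p))
    (hLTG : LocalToGlobal Γ) : Function.Injective (refinement Γ) := fun W W' h => by
  refine Set.Subset.antisymm (fun p hp => ?_) fun p hp => ?_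
  · exact mem_of_refinement_mem hF hτ hinj hΓ hLTG (h ▸ refinement_mem hp)
  · exact mem_of_refinement_mem hF hτ hinj hΓ hLTG (h ▸ refinement_mem hp)

theorem refinement_openSet (hF : IsSpatial F) (hτ : IsFrameMap τ)
    (hΓ : ∀ p, IsPointIdempotent τ p (Γ p)) (hLTG : LocalToGlobal Γ) (f : F) :
    refinement Γ (openSet f) = (τ f).toLocIdeal := by
  obtain ⟨A, hA⟩ := Idem.exists_represents (τ f)
  rw [← hA]
  change _ = A.ker
  refine le_antisymm (refinement_le fun p hp => (hΓ p).isZero_tensor_of_mem hF hτ hA hp)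
    fun X (hX : IsZero (A.obj ⊗ X)) => ?_
  refine (refinement_mem_iff hF hτ hΓ hLTG).2 fun p hp => ?_
  obtain ⟨C, hC⟩ := A.exists_isCoalgebra
  have hz := (hΓ p).isZero_tensor_of_notMem hF hτ hA hC hp
  obtain ⟨ε, δ, h⟩ := hC
  -- Since `A` kills `X`, there is an isomorphism `X ⊗ C ≅ X`, and `Γ p` kills `C`.
  have : IsIso (X ◁ ε) := (isIso_whiskerLeft_mor₁_iff X h).2 (isZero_tensor_comm hX)
  have e : X ⊗ C ≅ X := asIso (X ◁ ε) ≪≫ ρ_ X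
  exact (isZero_tensor_left_comm (isZero_tensor hz)).of_iso (whiskerLeftIso (Γ p) e.symm)

end Points

end TensorTriangulated

end BigTT

theorem mainTheorem5 {T : Type u} [Category.{v} T] [HasZeroObject T] [HasShift T ℤ]
    [Preadditive T] [∀ n : ℤ, (shiftFunctor T n).Additive] [Pretriangulated T] [IsTriangulated T]
    [MonoidalCategory T] [SymmetricCategory T] [HasCoproducts.{v} T] [BigTT.IsBigTTCategory T]
    {F : Type w} [Order.Frame F] (hF : BigTT.IsSpatial F) (hTD : BigTT.IsTD F)
    (τ : F → BigTT.Idem T) (hτ : BigTT.IsFrameMap τ) (hinj : Function.Injective τ)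
    (Γ : Locale.PT F → T) (hΓ : ∀ p, BigTT.IsPointIdempotent τ p (Γ p))
    (hLTG : BigTT.LocalToGlobal Γ) :
    ∃ υ : FrameHom (Set (Locale.PT F)) (BigTT.LocIdeal T),
      (∀ W : Set (Locale.PT F), υ W = BigTT.refinement Γ W) ∧
      BigTT.IsDiscretization τ υ ∧
      ∀ 𝒲 : Set (Set (Locale.PT F)), υ (sInf 𝒲) = sInf (υ '' 𝒲) := by
  refine ⟨BigTT.refinementHom hF hτ hΓ hLTG, fun _ => rfl, ⟨?_, ?_⟩, ?_⟩
  · exact BigTT.refinement_injective hF hτ hinj hΓ hLTG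
  · exact BigTT.refinement_openSet hF hτ hΓ hLTG
  · exact BigTT.refinement_sInf hF hτ hΓ hLTG
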